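/- Let $X$ and $Y$ be real random variables defined on a common probability space, each of which is continuous, i.e. has a continuous distribution function (equivalently $P(X=x)=P(Y=x)=0$ for all $x\in\mathbb{R}$); no joint density is assumed. For $z_1,\dots,z_4\in\mathbb{R}$ put $$a(z_1,z_2,z_3,z_4)=\operatorname{sign}\bigl(|z_1-z_2|+|z_3-z_4|-|z_1-z_3|-|z_2-z_4|\bigr),$$ where $\operatorname{sign}(t)$ is $1$, $0$ or $-1$ according to whether $t>0$, $t=0$ or $t<0$. Let $(X_1,Y_1),\dots,(X_4,Y_4)$ be independent and identically distributed copies of the pair $(X,Y)$, and define $$\tau^*(X,Y)=E\bigl[a(X_1,X_2,X_3,X_4)\,a(Y_1,Y_2,Y_3,Y_4)\bigr].$$ Then $\tau^*(X,Y)\ge 0$, and $\tau^*(X,Y)=0$ if and only if $X$ and $Y$ are independent. -/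

import Mathlib

open MeasureTheory ProbabilityTheory

/-- The sign function `a` of four real numbers,
`a(z₁,z₂,z₃,z₄) = sign(|z₁ - z₂| + |z₃ - z₄| - |z₁ - z₃| - |z₂ - z₄|)`. -/
noncomputable def signA (z₁ z₂ z₃ z₄ : ℝ) : ℝ :=
  Real.sign (|z₁ - z₂| + |z₃ - z₄| - |z₁ - z₃| - |z₂ - z₄|)

/-- The coefficient `τ*(X,Y) = E[a(X₁,X₂,X₃,X₄) a(Y₁,Y₂,Y₃,Y₄)]`. The iid copies
`(X₁,Y₁), …, (X₄,Y₄)` of `(X,Y)` are the coordinates on the fourfold product of the joint law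
of `(X,Y)`. -/
noncomputable def tauStar {Ω : Type*} [MeasurableSpace Ω] (μ : Measure Ω) (X Y : Ω → ℝ) : ℝ :=
  ∫ p : Fin 4 → ℝ × ℝ,
    signA (p 0).1 (p 1).1 (p 2).1 (p 3).1 * signA (p 0).2 (p 1).2 (p 2).2 (p 3).2
    ∂(Measure.pi fun _ : Fin 4 => μ.map fun ω => (X ω, Y ω))

/-!
For continuous marginals, `τ*` is a positive combination of two classical measures of dependence.
Let `F`, `F₁`, `F₂` be the joint and marginal distribution functions, `H = F - F₁F₂`
(`jointDefect`), and let `ν` be the joint law, with marginals `ν₁` and `ν₂`. Then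
`τ* = 12 ∫ H² dν + 24 ∫ H² d(ν₁ ⊗ ν₂)`
(`integral_crossing_mul_crossing`): Hoeffding's `D` and the Blum–Kiefer–Rosenblatt `R`. This gives
`τ* ≥ 0`. If `τ* = 0`, then `H` vanishes `ν₁ ⊗ ν₂`-almost everywhere, hence everywhere, because a
point with `H ≠ 0` would be the upper right corner of a rectangle of positive `ν₁ ⊗ ν₂`-mass on which
`H ≠ 0` (`jointDefect_eq_zero_of_integral_eq_zero`); and `H = 0` says that `X` and `Y` are
independent.

The identity comes from the combinatorics of six points. The sign `a(z₁,z₂,z₃,z₄)` (`crossing`) is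
the orientation of the overlap of the oriented intervals `[z₁,z₄]` and `[z₃,z₂]`, and
`overlap z₁ z₂ z₃ z₄ t` records whether `t` lies in this overlap, with the same sign. For six
independent points with law `ν`, the product of the overlap indicators of the first four, centred at
`(X₅, Y₅)` or at `(X₅, Y₆)`, has expectation `4 ∫ H² dν` or `4 ∫ H² d(ν₁ ⊗ ν₂)`, since
`E[(1_{U₁≤s} - 1_{V₁≤s})(1_{U₂≤t} - 1_{V₂≤t})] = 2 H(s,t)` for independent `U`, `V` with law `ν`. So
it suffices that `sixKernel`, which is `a a - 3 (overlap at (X₅, Y₅)) - 6 (overlap at (X₅, Y₆))`,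
has mean zero. Almost surely there are no ties, and for six points without ties the sum of
`sixKernel` over all relabellings is exactly zero (`sum_sixKernel_comp_eq_zero`). As the kernel
depends only on the order of the coordinates, this is a statement about each permutation of
six ranks; its symmetry group of order `8` shortens the sum, and it is then decided by evaluation.
-/

/-! ### The kernels and their symmetries -/

/-- The order-theoretic form of `signA`: it is `1` if the pair `{a, c}` lies entirely on one side of
`{b, d}`, it is `-1` if `{a, b}` lies entirely on one side of `{c, d}`, and `0` otherwise. -/
def crossing {α : Type*} [LinearOrder α] (a b c d : α) : ℤ :=
  if a < b ∧ a < d ∧ c < b ∧ c < d then 1 else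
  if b < a ∧ b < c ∧ d < a ∧ d < c then 1 else
  if a < c ∧ a < d ∧ b < c ∧ b < d then -1 else
  if c < a ∧ c < b ∧ d < a ∧ d < b then -1 else 0

/-- The difference `1_{a ≤ t} - 1_{b ≤ t}`, the indicator at `t` of the oriented interval from `a` to
`b`. -/
def stepDiff {α : Type*} [LinearOrder α] (a b t : α) : ℤ :=
  (if a ≤ t then 1 else 0) - (if b ≤ t then 1 else 0)

/-- The signed indicator at `t` of the overlap of the oriented intervals from `a` to `d` and from `c`
to `b`. For points without ties it is `crossing a b c d` if `t` lies between the two middle points of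
`a, b, c, d`, and `0` otherwise. -/
def overlap {α : Type*} [LinearOrder α] (a b c d t : α) : ℤ := stepDiff a d t * stepDiff c b t

/-- The kernel in six points comparing the product of two crossing signs with the overlap
indicators centred at `(x 4, y 4)` and at `(x 4, y 5)`. The coefficients `3` and `6` are the ones for
which it sums to zero over all relabellings of six points without ties. -/
def sixKernel {α β : Type*} [LinearOrder α] [LinearOrder β] (x : Fin 6 → α) (y : Fin 6 → β) : ℤ :=
  crossing (x 0) (x 1) (x 2) (x 3) * crossing (y 0) (y 1) (y 2) (y 3)
    - 3 * (overlap (x 0) (x 1) (x 2) (x 3) (x 4) * overlap (y 0) (y 1) (y 2) (y 3) (y 4))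
    - 6 * (overlap (x 0) (x 1) (x 2) (x 3) (x 4) * overlap (y 0) (y 1) (y 2) (y 3) (y 5))

/-- The kernel depends only on the relative order of its arguments. -/
lemma sixKernel_congr {α β α' β' : Type*} [LinearOrder α] [LinearOrder β] [LinearOrder α']
    [LinearOrder β'] {x : Fin 6 → α} {y : Fin 6 → β} {x' : Fin 6 → α'} {y' : Fin 6 → β'}
    (hx : ∀ i j, x i ≤ x j ↔ x' i ≤ x' j) (hy : ∀ i j, y i ≤ y j ↔ y' i ≤ y' j) :
    sixKernel x y = sixKernel x' y' := by
  have hx' : ∀ i j, x i < x j ↔ x' i < x' j := fun i j => by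
    rw [← not_le, ← not_le, hx]
  have hy' : ∀ i j, y i < y j ↔ y' i < y' j := fun i j => by
    rw [← not_le, ← not_le, hy]
  simp only [sixKernel, crossing, overlap, stepDiff, hx, hy, hx', hy']

lemma crossing_swap_outer {α : Type*} [LinearOrder α] {a b c d : α} :
    crossing d b c a = -crossing a b c d := by
  unfold crossing
  split_ifs <;> first | rfl | (exfalso; grind)

lemma crossing_swap_inner {α : Type*} [LinearOrder α] {a b c d : α} :
    crossing a c b d = -crossing a b c d := by
  unfold crossing
  split_ifs <;> first | rfl | (exfalso; grind)

lemma crossing_swap_pairs {α : Type*} [LinearOrder α] {a b c d : α} :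
    crossing c d a b = crossing a b c d := by
  unfold crossing
  split_ifs <;> first | rfl | (exfalso; grind)

lemma overlap_swap_outer {α : Type*} [LinearOrder α] {a b c d t : α} :
    overlap d b c a t = -overlap a b c d t := by
  unfold overlap stepDiff; ring

lemma overlap_swap_inner {α : Type*} [LinearOrder α] {a b c d t : α} :
    overlap a c b d t = -overlap a b c d t := by
  unfold overlap stepDiff; ring

lemma overlap_swap_pairs {α : Type*} [LinearOrder α] {a b c d t : α} :
    overlap c d a b t = overlap a b c d t := by
  unfold overlap stepDiff; ring

section
variable {α β : Type*} [LinearOrder α] [LinearOrder β] (x : Fin 6 → α) (y : Fin 6 → β)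

lemma sixKernel_swap_outer :
    sixKernel (x ∘ Equiv.swap 0 3) (y ∘ Equiv.swap 0 3) = sixKernel x y := by
  have e : (Equiv.swap 0 3 : Equiv.Perm (Fin 6)) 1 = 1 ∧
    (Equiv.swap 0 3 : Equiv.Perm (Fin 6)) 2 = 2 ∧
    (Equiv.swap 0 3 : Equiv.Perm (Fin 6)) 4 = 4 ∧ (Equiv.swap 0 3 : Equiv.Perm (Fin 6)) 5 = 5 := by
    decide
  simp only [sixKernel, Function.comp_apply, Equiv.swap_apply_left, Equiv.swap_apply_right, e,
    crossing_swap_outer (α := α) (a := x 0), crossing_swap_outer (α := β) (a := y 0),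
    overlap_swap_outer (α := α) (a := x 0), overlap_swap_outer (α := β) (a := y 0)]
  ring

lemma sixKernel_swap_inner :
    sixKernel (x ∘ Equiv.swap 1 2) (y ∘ Equiv.swap 1 2) = sixKernel x y := by
  have e : (Equiv.swap 1 2 : Equiv.Perm (Fin 6)) 0 = 0 ∧
    (Equiv.swap 1 2 : Equiv.Perm (Fin 6)) 3 = 3 ∧
    (Equiv.swap 1 2 : Equiv.Perm (Fin 6)) 4 = 4 ∧ (Equiv.swap 1 2 : Equiv.Perm (Fin 6)) 5 = 5 := by
    decide
  simp only [sixKernel, Function.comp_apply, Equiv.swap_apply_left, Equiv.swap_apply_right, e,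
    crossing_swap_inner (α := α) (b := x 1), crossing_swap_inner (α := β) (b := y 1),
    overlap_swap_inner (α := α) (b := x 1), overlap_swap_inner (α := β) (b := y 1)]
  ring

lemma swap_mul_swap_apply : ∀ i : Fin 6,
    (Equiv.swap 0 2 * Equiv.swap 1 3 : Equiv.Perm (Fin 6)) i = ![2, 3, 0, 1, 4, 5] i := by
  decide

lemma sixKernel_swap_pairs :
    sixKernel (x ∘ (Equiv.swap 0 2 * Equiv.swap 1 3 : Equiv.Perm (Fin 6)))
      (y ∘ (Equiv.swap 0 2 * Equiv.swap 1 3 : Equiv.Perm (Fin 6))) = sixKernel x y := by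
  simp only [sixKernel, Function.comp_apply, swap_mul_swap_apply]
  simp [crossing_swap_pairs (α := α) (a := x 0), crossing_swap_pairs (α := β) (a := y 0),
    overlap_swap_pairs (α := α) (a := x 0), overlap_swap_pairs (α := β) (a := y 0)]
end

/-- If `F` is invariant under right translation by `g`, and `g` exchanges `p` with its negation, then
half of the sum of `F` comes from `p`. -/
lemma sum_eq_two_mul_sum_ite {G : Type*} [Group G] [Fintype G] (F : G → ℤ) (g : G)
    (hF : ∀ s, F (s * g) = F s) (p : G → Prop) [DecidablePred p] (hp : ∀ s, p (s * g) ↔ ¬ p s) :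
    ∑ s, F s = 2 * ∑ s, if p s then F s else 0 := by
  have h1 : ∑ s, (if p s then 0 else F s) = ∑ s, if p s then F s else 0 := by
    rw [← Equiv.sum_comp (Equiv.mulRight g)]
    refine Finset.sum_congr rfl fun s _ => ?_
    simp only [Equiv.coe_mulRight, hp, hF]
    split_ifs <;> simp_all
  have h2 : ∑ s, F s = ∑ s, (if p s then F s else 0) + ∑ s, if p s then 0 else F s := by
    rw [← Finset.sum_add_distrib]
    refine Finset.sum_congr rfl fun s _ => ?_
    split_ifs <;> simp
  rw [h2, h1]; ring

/-! ### Vanishing of the symmetrized kernel -/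

open Equiv in
/-- The symmetries `0 ↔ 3`, `1 ↔ 2` and `(0 2)(1 3)` of the kernel generate a group of order `8`, and
the inequalities on the right select one element of each coset. -/
lemma sum_sixKernel_perm_eq_eight_mul (π : Perm (Fin 6)) :
    ∑ s : Perm (Fin 6), sixKernel s (π ∘ s) =
      8 * ∑ s : Perm (Fin 6), if s 0 < s 2 ∧ s 2 < s 1 ∧ s 0 < s 3 then
        sixKernel s (π ∘ s) else 0 := by
  have key : ∀ (s g : Perm (Fin 6)),
      (∀ x y : Fin 6 → Fin 6, sixKernel (x ∘ g) (y ∘ g) = sixKernel x y) →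
      sixKernel (s * g : Perm (Fin 6)) (π ∘ (s * g : Perm (Fin 6))) = sixKernel s (π ∘ s) :=
    fun s g h => by
    rw [← h s (π ∘ s)]; rfl
  have hne : ∀ (s : Perm (Fin 6)) (i j : Fin 6), i ≠ j → (s j < s i ↔ ¬ s i < s j) := fun s i j h => by
    have := s.injective.ne h
    rw [not_lt, le_iff_lt_or_eq]
    simp [Ne.symm this]
  rw [sum_eq_two_mul_sum_ite (fun s : Perm (Fin 6) => sixKernel s (π ∘ s)) (swap 0 3)
    (fun s => key s _ sixKernel_swap_outer) (fun s => s 0 < s 3)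
    (fun s => by simpa using hne s 0 3 (by decide))]
  rw [sum_eq_two_mul_sum_ite _ (swap 1 2) ?_ (fun s => s 2 < s 1)
    (fun s => by simpa using hne s 2 1 (by decide))]
  rw [sum_eq_two_mul_sum_ite _ (swap 0 2 * swap 1 3) ?_ (fun s => s 0 < s 2)
    (fun s => by
      simp only [Perm.mul_apply s, swap_mul_swap_apply]
      simpa using hne s 0 2 (by decide))]
  · rw [← mul_assoc, ← mul_assoc]
    norm_num
    refine Finset.sum_congr rfl fun s _ => ?_
    simp only [← ite_and]
  · intro s
    rw [key s _ sixKernel_swap_pairs]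
    simp only [Perm.mul_apply s, swap_mul_swap_apply]
    by_cases h1 : s 0 < s 3 <;> by_cases h2 : s 2 < s 1 <;> simp [h1, h2]
  · intro s
    rw [key s _ sixKernel_swap_inner]
    have e : (Equiv.swap 1 2 : Equiv.Perm (Fin 6)) 0 = 0 ∧
        (Equiv.swap 1 2 : Equiv.Perm (Fin 6)) 3 = 3 := by
      decide
    simp only [Perm.mul_apply s, e]

/-- The permutations of `Fin 6`, written as words, are the entries of the list
`List.permutations' [0, 1, 2, 3, 4, 5]`, which the Lean kernel evaluates easily. -/
lemma map_ofFn_univ_eq_permutations' :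
    ((Finset.univ : Finset (Equiv.Perm (Fin 6))).val.map fun s => List.ofFn fun i => (s i : ℕ)) =
      (([0, 1, 2, 3, 4, 5] : List ℕ).permutations' : Multiset (List ℕ)) := by
  refine (Multiset.Nodup.ext ?_ ?_).2 fun l => ?_
  · refine Multiset.Nodup.map ?_ Finset.univ.nodup
    intro s t h
    ext i
    exact congrFun (List.ofFn_injective h) i
  · exact Multiset.coe_nodup.2 ((List.permutations_perm_permutations' _).nodup_iff.1
      (List.nodup_permutations _ (by decide)))
  · simp only [Multiset.mem_map, Finset.mem_val, Finset.mem_univ, true_and, Multiset.mem_coe,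
      List.mem_permutations']
    have e0 : ([0, 1, 2, 3, 4, 5] : List ℕ) = List.ofFn fun i : Fin 6 => (i : ℕ) := by
      simp [List.ofFn_succ]
    constructor
    · rintro ⟨s, rfl⟩
      rw [e0]
      exact Equiv.Perm.ofFn_comp_perm s (fun i : Fin 6 => (i : ℕ))
    · intro h
      have hl : l.length = 6 := h.length_eq
      have hn : l.Nodup := h.nodup_iff.2 (by decide)
      have hlt : ∀ i : Fin 6, l[i] < 6 := fun i => by
        have : l[i] ∈ ([0, 1, 2, 3, 4, 5] : List ℕ) := h.mem_iff.1 (List.getElem_mem _)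
        exact (by decide : ∀ k ∈ ([0, 1, 2, 3, 4, 5] : List ℕ), k < 6) _ this
      have hinj : Function.Injective fun i : Fin 6 => (⟨l[i], hlt i⟩ : Fin 6) := by
        intro i j hij
        simp only [Fin.mk.injEq] at hij
        exact Fin.ext ((hn.getElem_inj_iff).1 hij)
      refine ⟨Equiv.ofBijective _ (Finite.injective_iff_bijective.1 hinj), ?_⟩
      apply List.ext_getElem (by simp [hl])
      intro i h1 h2
      rw [List.getElem_ofFn]
      rfl

/-! ### Evaluation for six ranks -/

/-- Whether `a` and `b` are both smaller than `c` and `d`; a form made for evaluation in the Lean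
kernel, which computes `Nat.ble` natively. -/
def sepN (a b c d : ℕ) : Bool :=
  bif Nat.ble c a then false else bif Nat.ble d a then false else
  bif Nat.ble c b then false else !(Nat.ble d b)

/-- Evaluable form of `crossing`. -/
def crossN (a b c d : ℕ) : ℤ :=
  bif sepN a c b d then 1 else bif sepN b d a c then 1 else
  bif sepN a b c d then -1 else bif sepN c d a b then -1 else 0

/-- Evaluable form of `stepDiff`. -/
def stepDiffN (a b t : ℕ) : ℤ :=
  bif Nat.ble a t then (bif Nat.ble b t then 0 else 1) else (bif Nat.ble b t then -1 else 0)

/-- Evaluable form of `overlap`. -/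
def overlapN (a b c d t : ℕ) : ℤ := stepDiffN a d t * stepDiffN c b t

/-- The value of `sixKernel` at a word `w = [a, b, c, d, m, n]` and its image under the permutation
whose values are listed in `l`, valid when `w` satisfies `isReduced`. Then the crossing sign of
`a, b, c, d` is `1`, and their overlap is the interval from `c` to the smaller of `b` and `d`. -/
def listKernel (l : List ℕ) : List ℕ → ℤ
  | [a, b, c, d, m, n] =>
    crossN (l.getD a 0) (l.getD b 0) (l.getD c 0) (l.getD d 0)
      - bif Nat.ble c m && !Nat.ble d m && !Nat.ble b m then
          3 * overlapN (l.getD a 0) (l.getD b 0) (l.getD c 0) (l.getD d 0) (l.getD m 0)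
          + 6 * overlapN (l.getD a 0) (l.getD b 0) (l.getD c 0) (l.getD d 0) (l.getD n 0)
        else 0
  | _ => 0

/-- The words `[a, b, c, d, m, n]` with `a < c < b` and `c < d`. They are the coset representatives
`a < c < b`, `a < d` of the symmetry group of `sixKernel` with nonzero crossing sign. -/
def isReduced : List ℕ → Bool
  | [a, b, c, d, _, _] => Nat.blt a c && (Nat.blt c b && Nat.blt c d)
  | _ => false

/-- The combinatorial core: the kernel sums to zero over the reduced words, for each of the `720`
permutations. -/
lemma sum_listKernel_eq_zero : ∀ l ∈ ([0, 1, 2, 3, 4, 5] : List ℕ).permutations',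
    ((([0, 1, 2, 3, 4, 5] : List ℕ).permutations'.filter isReduced).map (listKernel l)).sum = 0 := by
  decide +kernel

lemma ble_eq_decide (a b : ℕ) : Nat.ble a b = decide (a ≤ b) := by
  rw [Bool.eq_iff_iff]; simp

lemma sepN_eq (a b c d : ℕ) : sepN a b c d = decide (a < c ∧ a < d ∧ b < c ∧ b < d) := by
  simp only [sepN, ble_eq_decide, cond_eq_ite, decide_eq_true_eq]
  grind

lemma crossN_eq (a b c d : ℕ) : crossN a b c d = crossing a b c d := by
  simp only [crossN, crossing, sepN_eq, Bool.cond_decide]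

lemma overlapN_eq (a b c d t : ℕ) : overlapN a b c d t = overlap a b c d t := by
  have h (a b t : ℕ) : stepDiffN a b t = stepDiff a b t := by
    simp only [stepDiffN, stepDiff, cond_eq_ite, Nat.ble_eq]
    split_ifs <;> rfl
  simp only [overlapN, overlap, h]

/-- On the coset representatives, `listKernel` restricted to reduced words computes `sixKernel`: for
`x 3 ≤ x 2` both the crossing sign and the overlaps of `x` vanish. -/
lemma ite_listKernel_eq_sixKernel (x : Fin 6 → ℕ) (l : List ℕ) (h02 : x 0 < x 2) (h21 : x 2 < x 1)
    (h03 : x 0 < x 3) :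
    (if isReduced (List.ofFn x) then listKernel l (List.ofFn x) else 0) =
      sixKernel x fun i => l.getD (x i) 0 := by
  have e : List.ofFn x = [x 0, x 1, x 2, x 3, x 4, x 5] := by simp [List.ofFn_succ]
  have e1 : crossing (x 0) (x 1) (x 2) (x 3) = if x 2 < x 3 then 1 else 0 := by
    unfold crossing; grind
  have e2 (t : ℕ) : overlap (x 0) (x 1) (x 2) (x 3) t =
      if x 2 ≤ t ∧ t < x 3 ∧ t < x 1 then 1 else 0 := by
    unfold overlap stepDiff; grind
  simp only [e, isReduced, listKernel, sixKernel, crossN_eq, overlapN_eq, e1, e2]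
  have e3 : (Nat.ble (x 2) (x 4) && !Nat.ble (x 3) (x 4) && !Nat.ble (x 1) (x 4)) =
      decide (x 2 ≤ x 4 ∧ x 4 < x 3 ∧ x 4 < x 1) := by
    rw [Bool.eq_iff_iff]
    simp only [ble_eq_decide, Bool.and_eq_true, Bool.not_eq_true', decide_eq_true_eq,
      decide_eq_false_iff_not, not_le, and_assoc]
  have e4 : (Nat.blt (x 0) (x 2) && (Nat.blt (x 2) (x 1) && Nat.blt (x 2) (x 3))) =
      decide (x 2 < x 3) := by
    rw [Bool.eq_iff_iff]
    simp [h02, h21]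
  rw [e3, e4]
  simp only [Bool.cond_decide, decide_eq_true_eq]
  split_ifs <;> first | (exfalso; omega) | ring

lemma sum_sixKernel_perm_comp_eq_zero (π : Equiv.Perm (Fin 6)) :
    ∑ s : Equiv.Perm (Fin 6), sixKernel s (π ∘ s) = 0 := by
  set l : List ℕ := List.ofFn fun i => (π i : ℕ) with hl
  have hmem : l ∈ ([0, 1, 2, 3, 4, 5] : List ℕ).permutations' := by
    rw [← Multiset.mem_coe, ← map_ofFn_univ_eq_permutations']
    exact Multiset.mem_map_of_mem _ (Finset.mem_univ π)
  have hlist : ∀ L : List (List ℕ), (L.map fun a => if isReduced a then listKernel l a else 0).sum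
      = ((L.filter isReduced).map (listKernel l)).sum := fun L => by
    induction L with
    | nil => rfl
    | cons a L ih => by_cases h : isReduced a <;> simp [h, ih]
  have h0 := sum_listKernel_eq_zero l hmem
  rw [← hlist, ← Multiset.sum_coe, ← Multiset.map_coe, ← map_ofFn_univ_eq_permutations',
    Multiset.map_map] at h0
  rw [sum_sixKernel_perm_eq_eight_mul, mul_eq_zero]
  refine Or.inr (Eq.trans ?_ h0)
  change _ = ∑ s : Equiv.Perm (Fin 6), _
  refine Finset.sum_congr rfl fun s _ => ?_
  simp only [Function.comp_apply]
  by_cases h : s 0 < s 2 ∧ s 2 < s 1 ∧ s 0 < s 3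
  · rw [if_pos h, ite_listKernel_eq_sixKernel (fun i => (s i : ℕ)) l h.1 h.2.1 h.2.2]
    refine sixKernel_congr (fun i j => Iff.rfl) fun i j => ?_
    have hget : ∀ k : Fin 6, l.getD k 0 = π k := fun k => by
      rw [List.getD_eq_getElem _ _ (by simp [hl]), List.getElem_ofFn]
    simp only [Function.comp_apply, hget, Fin.val_fin_le]
  · rw [if_neg h]
    have e : (List.ofFn fun i => (s i : ℕ)) =
        [(s 0 : ℕ), (s 1 : ℕ), (s 2 : ℕ), (s 3 : ℕ), (s 4 : ℕ), (s 5 : ℕ)] := by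
      simp [List.ofFn_succ]
    rw [if_neg]
    rw [e]
    simp only [isReduced, Bool.and_eq_true, Nat.blt_eq, Fin.val_fin_lt]
    grind

/-- For six points without ties, the kernel sums to zero over all relabellings. Replacing coordinates
by ranks and relabelling the points by increasing `x` reduces this to `x = id`. -/
theorem sum_sixKernel_comp_eq_zero {α β : Type*} [LinearOrder α] [LinearOrder β]
    {x : Fin 6 → α} {y : Fin 6 → β} (hx : Function.Injective x) (hy : Function.Injective y) :
    ∑ s : Equiv.Perm (Fin 6), sixKernel (x ∘ s) (y ∘ s) = 0 := by
  have hsx := (Tuple.monotone_sort x).strictMono_of_injective (hx.comp (Tuple.sort x).injective)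
  have hsy := (Tuple.monotone_sort y).strictMono_of_injective (hy.comp (Tuple.sort y).injective)
  set ρ := (Tuple.sort x)⁻¹ with hρ
  set τ := (Tuple.sort y)⁻¹ with hτ
  have hx' (i j) : x i ≤ x j ↔ ρ i ≤ ρ j := by
    rw [← hsx.le_iff_le]; simp [hρ]
  have hy' (i j) : y i ≤ y j ↔ τ i ≤ τ j := by
    rw [← hsy.le_iff_le]; simp [hτ]
  rw [← Equiv.sum_comp (Equiv.mulLeft ρ⁻¹), ← sum_sixKernel_perm_comp_eq_zero (τ * ρ⁻¹)]
  refine Finset.sum_congr rfl fun s _ => ?_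
  refine sixKernel_congr (fun i j => ?_) fun i j => ?_
  · simp [hx']
  · simp [hy']

/-! ### Integrals over finite powers of a probability measure -/

section
variable {α : Type*} [MeasurableSpace α] (ν : Measure α) [IsProbabilityMeasure ν]

lemma integral_pi_comp_perm {ι : Type*} [Fintype ι] (f : (ι → α) → ℝ) (σ : Equiv.Perm ι) :
    ∫ p, f (p ∘ σ) ∂(Measure.pi fun _ => ν) = ∫ p, f p ∂(Measure.pi fun _ => ν) := by
  have h := (measurePreserving_piCongrLeft (fun _ : ι => ν) σ.symm).integral_comp' f
  rw [← h]
  refine integral_congr_ae (Filter.Eventually.of_forall fun p => ?_)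
  simp only
  congr 1
  ext i
  have := MeasurableEquiv.piCongrLeft_apply_apply σ.symm (β := fun _ => α) p (σ i)
  simpa using this.symm

lemma integral_pi_fin_succ {n : ℕ} (f : (Fin (n + 1) → α) → ℝ) (hf : Measurable f) (C : ℝ)
    (hC : ∀ p, |f p| ≤ C) :
    ∫ p, f p ∂(Measure.pi fun _ => ν) =
      ∫ a, ∫ p, f (Fin.cons a p) ∂(Measure.pi fun _ => ν) ∂ν := by
  have h := ((measurePreserving_piFinSuccAbove (fun _ : Fin (n + 1) => ν) 0).symm).integral_comp' f
  rw [← h, integral_prod]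
  · simp [MeasurableEquiv.piFinSuccAbove_symm_apply, Fin.insertNthEquiv]
  · refine Integrable.of_bound ?_ C (Filter.Eventually.of_forall fun p => hC _)
    exact (hf.comp (MeasurableEquiv.measurable _)).aestronglyMeasurable

lemma measurable_fin_cons {n : ℕ} (a : α) :
    Measurable fun p : Fin n → α => (Fin.cons a p : Fin (n + 1) → α) := by
  refine measurable_pi_iff.2 fun i => ?_
  refine Fin.cases ?_ (fun j => ?_) i
  · simp
  · simpa using measurable_pi_apply j

lemma integral_pi_fin_four (f : (Fin 4 → α) → ℝ) (hf : Measurable f) (C : ℝ)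
    (hC : ∀ p, |f p| ≤ C) :
    ∫ p, f p ∂(Measure.pi fun _ => ν) = ∫ a, ∫ b, ∫ c, ∫ d, f ![a, b, c, d] ∂ν ∂ν ∂ν ∂ν := by
  rw [integral_pi_fin_succ ν f hf C hC]
  refine integral_congr_ae (.of_forall fun a => ?_)
  have h1 := hf.comp (measurable_fin_cons (n := 3) a)
  refine (integral_pi_fin_succ ν _ h1 C fun p => hC _).trans ?_
  refine integral_congr_ae (.of_forall fun b => ?_)
  have h2 := h1.comp (measurable_fin_cons (n := 2) b)
  refine (integral_pi_fin_succ ν _ h2 C fun p => hC _).trans ?_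
  refine integral_congr_ae (.of_forall fun c => ?_)
  have h3 := h2.comp (measurable_fin_cons (n := 1) c)
  refine (integral_pi_fin_succ ν _ h3 C fun p => hC _).trans ?_
  refine integral_congr_ae (.of_forall fun d => ?_)
  rw [Measure.pi_of_empty]
  exact (integral_dirac _ _).trans rfl

lemma integral_pi_fin_six (f : (Fin 6 → α) → ℝ) (hf : Measurable f) (C : ℝ)
    (hC : ∀ p, |f p| ≤ C) :
    ∫ p, f p ∂(Measure.pi fun _ => ν) =
      ∫ m, ∫ n, ∫ a, ∫ b, ∫ c, ∫ d, f ![m, n, a, b, c, d] ∂ν ∂ν ∂ν ∂ν ∂ν ∂ν := by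
  rw [integral_pi_fin_succ ν f hf C hC]
  refine integral_congr_ae (.of_forall fun m => ?_)
  have h1 := hf.comp (measurable_fin_cons (n := 5) m)
  refine (integral_pi_fin_succ ν _ h1 C fun p => hC _).trans ?_
  refine integral_congr_ae (.of_forall fun n => ?_)
  have h2 := h1.comp (measurable_fin_cons (n := 4) n)
  exact integral_pi_fin_four ν _ h2 C fun p => hC _

lemma integral_pi_fin_six_of_four (f : (Fin 4 → α) → ℝ) (hf : Measurable f) (C : ℝ)
    (hC : ∀ p, |f p| ≤ C) :
    ∫ p : Fin 6 → α, f ![p 0, p 1, p 2, p 3] ∂(Measure.pi fun _ => ν) =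
      ∫ p, f p ∂(Measure.pi fun _ => ν) := by
  have hm : Measurable fun p : Fin 6 → α => (![p 0, p 1, p 2, p 3] : Fin 4 → α) := by
    refine measurable_pi_iff.2 fun i => ?_
    fin_cases i <;> exact measurable_pi_apply _
  refine (integral_pi_fin_six ν _ (hf.comp hm) C fun p => hC _).trans ?_
  rw [integral_pi_fin_four ν f hf C hC]
  simp
end

/-! ### Absence of ties, measurability and bounds -/

/-- If `φ` has an atomless law, its values at independent points are almost surely distinct. -/
lemma ae_injective_comp (ν : Measure (ℝ × ℝ)) [IsProbabilityMeasure ν] (φ : ℝ × ℝ → ℝ)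
    (hφ : Measurable φ) (hν : ∀ x, ν {q | φ q = x} = 0) {ι : Type*} [Fintype ι] :
    ∀ᵐ p : ι → ℝ × ℝ ∂(Measure.pi fun _ => ν), Function.Injective fun i => φ (p i) := by
  have key : ∀ i j : ι, ∀ᵐ p : ι → ℝ × ℝ ∂(Measure.pi fun _ => ν), i ≠ j → φ (p i) ≠ φ (p j) := by
    intro i j
    by_cases hij : i = j
    · simp [hij]
    have hind := (iIndepFun_pi (μ := fun _ : ι => ν) (X := fun _ q => q)
      fun _ => aemeasurable_id).indepFun hij
    rw [indepFun_iff_map_prod_eq_prod_map_map (measurable_pi_apply i).aemeasurable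
      (measurable_pi_apply j).aemeasurable] at hind
    have hi : ∀ k, Measure.map (fun p : ι → ℝ × ℝ => p k) (Measure.pi fun _ => ν) = ν := fun k =>
      (measurePreserving_eval (fun _ : ι => ν) k).map_eq
    simp only [hi] at hind
    have hs : MeasurableSet {q : (ℝ × ℝ) × (ℝ × ℝ) | φ q.1 = φ q.2} :=
      measurableSet_eq_fun (by fun_prop) (by fun_prop)
    have h0 : (ν.prod ν) {q : (ℝ × ℝ) × (ℝ × ℝ) | φ q.1 = φ q.2} = 0 := by
      rw [Measure.measure_prod_null hs]
      refine .of_forall fun q => ?_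
      simpa [Set.preimage, eq_comm] using hν (φ q)
    rw [← hind, Measure.map_apply (by fun_prop) hs] at h0
    filter_upwards [measure_eq_zero_iff_ae_notMem.1 h0] with p hp _ using hp
  filter_upwards [ae_all_iff.2 fun i => ae_all_iff.2 (key i)] with p hp i j h
  by_contra hij
  exact hp i j hij h

section
variable {Ω : Type*} [MeasurableSpace Ω] {a b c d t : Ω → ℝ}

lemma measurable_crossing (ha : Measurable a) (hb : Measurable b) (hc : Measurable c)
    (hd : Measurable d) : Measurable fun ω => (crossing (a ω) (b ω) (c ω) (d ω) : ℝ) := by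
  have h {f g : Ω → ℝ} (hf : Measurable f) (hg : Measurable g) := measurableSet_lt hf hg
  have h' {f g k l : Ω → ℝ} (hf : Measurable f) (hg : Measurable g) (hk : Measurable k)
      (hl : Measurable l) : MeasurableSet {ω | f ω < k ω ∧ f ω < l ω ∧ g ω < k ω ∧ g ω < l ω} :=
    (h hf hk).inter ((h hf hl).inter ((h hg hk).inter (h hg hl)))
  simp only [crossing]
  push_cast
  refine Measurable.ite (h' ha hc hb hd) measurable_const (Measurable.ite (h' hb hd ha hc)
    measurable_const (Measurable.ite (h' ha hb hc hd) measurable_const (Measurable.ite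
    (h' hc hd ha hb) measurable_const measurable_const)))

lemma measurable_stepDiff (ha : Measurable a) (hb : Measurable b) (ht : Measurable t) :
    Measurable fun ω => (stepDiff (a ω) (b ω) (t ω) : ℝ) := by
  simp only [stepDiff]
  push_cast
  exact (Measurable.ite (measurableSet_le ha ht) measurable_const measurable_const).sub
    (Measurable.ite (measurableSet_le hb ht) measurable_const measurable_const)

lemma measurable_overlap (ha : Measurable a) (hb : Measurable b) (hc : Measurable c)
    (hd : Measurable d) (ht : Measurable t) :
    Measurable fun ω => (overlap (a ω) (b ω) (c ω) (d ω) (t ω) : ℝ) := by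
  simp only [overlap]
  push_cast
  exact (measurable_stepDiff ha hd ht).mul (measurable_stepDiff hc hb ht)
end

lemma abs_crossing_le_one (a b c d : ℝ) : |(crossing a b c d : ℝ)| ≤ 1 := by
  unfold crossing; split_ifs <;> simp

lemma abs_stepDiff_le_one (a b t : ℝ) : |(stepDiff a b t : ℝ)| ≤ 1 := by
  unfold stepDiff; split_ifs <;> simp

lemma abs_overlap_le_one (a b c d t : ℝ) : |(overlap a b c d t : ℝ)| ≤ 1 := by
  unfold overlap
  push_cast
  rw [abs_mul]
  exact mul_le_one₀ (abs_stepDiff_le_one _ _ _) (abs_nonneg _) (abs_stepDiff_le_one _ _ _)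

lemma signA_eq_crossing (a b c d : ℝ) : signA a b c d = crossing a b c d := by
  have key : signA a b c d = if a < b ∧ a < d ∧ c < b ∧ c < d then 1 else
      if b < a ∧ b < c ∧ d < a ∧ d < c then 1 else
      if a < c ∧ a < d ∧ b < c ∧ b < d then -1 else
      if c < a ∧ c < b ∧ d < a ∧ d < b then -1 else 0 := by
    unfold signA
    split_ifs with h1 h2 h3 h4
    · exact Real.sign_of_pos (by grind)
    · exact Real.sign_of_pos (by grind)
    · exact Real.sign_of_neg (by grind)
    · exact Real.sign_of_neg (by grind)
    · rw [← Real.sign_zero]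
      congr 1
      rcases abs_cases (a - b) with h | h <;> rcases abs_cases (c - d) with h' | h' <;>
      rcases abs_cases (a - c) with k | k <;> rcases abs_cases (b - d) with k' | k' <;>
      rw [h.1, h'.1, k.1, k'.1] <;> grind
  rw [key, crossing]
  push_cast
  rfl

/-! ### The decomposition of the mean -/

/-- The mean is the mean of the average over relabellings, which vanishes almost surely. -/
lemma integral_sixKernel_eq_zero (ν : Measure (ℝ × ℝ)) [IsProbabilityMeasure ν]
    (h1 : ∀ x, ν {q | q.1 = x} = 0) (h2 : ∀ y, ν {q | q.2 = y} = 0)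
    (hint : Integrable (fun p : Fin 6 → ℝ × ℝ =>
      (sixKernel (fun i => (p i).1) (fun i => (p i).2) : ℝ)) (Measure.pi fun _ => ν)) :
    ∫ p : Fin 6 → ℝ × ℝ, (sixKernel (fun i => (p i).1) (fun i => (p i).2) : ℝ)
      ∂(Measure.pi fun _ => ν) = 0 := by
  set f : (Fin 6 → ℝ × ℝ) → ℝ := fun p => (sixKernel (fun i => (p i).1) (fun i => (p i).2) : ℝ)
    with hf
  have hsum : ∀ᵐ p ∂(Measure.pi fun _ : Fin 6 => ν), ∑ s : Equiv.Perm (Fin 6), f (p ∘ s) = 0 := by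
    filter_upwards [ae_injective_comp ν Prod.fst measurable_fst h1 (ι := Fin 6),
      ae_injective_comp ν Prod.snd measurable_snd h2 (ι := Fin 6)] with p hp1 hp2
    have := sum_sixKernel_comp_eq_zero hp1 hp2
    simp only [hf]
    exact_mod_cast this
  have hs : ∀ s : Equiv.Perm (Fin 6), ∫ p, f (p ∘ s) ∂(Measure.pi fun _ => ν) =
      ∫ p, f p ∂(Measure.pi fun _ => ν) := integral_pi_comp_perm ν f
  have hi : ∀ s : Equiv.Perm (Fin 6), Integrable (fun p => f (p ∘ s)) (Measure.pi fun _ => ν) := by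
    intro s
    have h := (measurePreserving_piCongrLeft (fun _ : Fin 6 => ν) s.symm).integrable_comp_emb
      (MeasurableEquiv.measurableEmbedding _) (g := f)
    convert h.2 hint using 1
    ext p
    simp only [Function.comp_apply]
    congr 1
    ext i : 1
    have := MeasurableEquiv.piCongrLeft_apply_apply s.symm (β := fun _ => ℝ × ℝ) p (s i)
    simpa using this.symm
  have h : ∑ s : Equiv.Perm (Fin 6), ∫ p, f (p ∘ s) ∂(Measure.pi fun _ => ν) = 0 := by
    rw [← integral_finsetSum _ fun s _ => hi s]
    exact integral_eq_zero_of_ae hsum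
  simp only [hs, Finset.sum_const, nsmul_eq_mul, mul_eq_zero, Nat.cast_eq_zero,
    Finset.card_eq_zero, Finset.univ_eq_empty_iff, not_isEmpty_of_nonempty, false_or] at h
  exact h

/-- The deviation `F - F₁F₂` of the joint distribution function of `ν` from the product of its
marginal distribution functions. -/
noncomputable def jointDefect (ν : Measure (ℝ × ℝ)) (s t : ℝ) : ℝ :=
  ν.real {q | q.1 ≤ s ∧ q.2 ≤ t} - ν.real {q | q.1 ≤ s} * ν.real {q | q.2 ≤ t}

/-- The left side is twice the covariance of `1_{q.1 ≤ s}` and `1_{q.2 ≤ t}` under `ν`. -/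
lemma integral_stepDiff_mul_step (ν : Measure (ℝ × ℝ)) [IsProbabilityMeasure ν] (s t : ℝ) :
    ∫ u, ∫ v, (stepDiff u.1 v.1 s * stepDiff u.2 v.2 t : ℝ) ∂ν ∂ν = 2 * jointDefect ν s t := by
  set I : ℝ × ℝ → ℝ := Set.indicator {q | q.1 ≤ s} 1 with hI
  set J : ℝ × ℝ → ℝ := Set.indicator {q | q.2 ≤ t} 1 with hJ
  have hmI : MeasurableSet {q : ℝ × ℝ | q.1 ≤ s} :=
    measurableSet_le measurable_fst measurable_const
  have hmJ : MeasurableSet {q : ℝ × ℝ | q.2 ≤ t} :=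
    measurableSet_le measurable_snd measurable_const
  have hmIJ : MeasurableSet {q : ℝ × ℝ | q.1 ≤ s ∧ q.2 ≤ t} := hmI.inter hmJ
  have hIJ : (fun q => I q * J q) = Set.indicator {q | q.1 ≤ s ∧ q.2 ≤ t} 1 := by
    ext q
    simp only [hI, hJ, Set.indicator_apply, Set.mem_ofPred_eq, Pi.one_apply]
    split_ifs <;> simp_all
  have ii (A : Set (ℝ × ℝ)) (hA : MeasurableSet A) : Integrable (A.indicator (1 : ℝ × ℝ → ℝ)) ν :=
    (integrable_const (1 : ℝ)).indicator hA
  have iI : Integrable I ν := ii _ hmI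
  have iJ : Integrable J ν := ii _ hmJ
  have iIJ : Integrable (fun q => I q * J q) ν := by rw [hIJ]; exact ii _ hmIJ
  have eI : ∫ q, I q ∂ν = ν.real {q | q.1 ≤ s} := integral_indicator_one hmI
  have eJ : ∫ q, J q ∂ν = ν.real {q | q.2 ≤ t} := integral_indicator_one hmJ
  have eIJ : ∫ q, I q * J q ∂ν = ν.real {q | q.1 ≤ s ∧ q.2 ≤ t} := by
    rw [hIJ]; exact integral_indicator_one hmIJ
  have hstep (u v : ℝ × ℝ) : (stepDiff u.1 v.1 s * stepDiff u.2 v.2 t : ℝ) =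
      I u * J u - I u * J v - J u * I v + I v * J v := by
    have e1 : (stepDiff u.1 v.1 s : ℝ) = I u - I v := by
      simp [stepDiff, hI, Set.indicator_apply]
    have e2 : (stepDiff u.2 v.2 t : ℝ) = J u - J v := by
      simp [stepDiff, hJ, Set.indicator_apply]
    rw [e1, e2]; ring
  simp only [hstep]
  have inner (u : ℝ × ℝ) : ∫ v, (I u * J u - I u * J v - J u * I v + I v * J v) ∂ν =
      I u * J u - I u * ν.real {q | q.2 ≤ t} - J u * ν.real {q | q.1 ≤ s}
        + ν.real {q | q.1 ≤ s ∧ q.2 ≤ t} := by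
    rw [integral_add (((integrable_const _).sub' (iJ.const_mul _)).sub' (iI.const_mul _)) iIJ,
      integral_sub ((integrable_const _).sub' (iJ.const_mul _)) (iI.const_mul _),
      integral_sub (integrable_const _) (iJ.const_mul _), integral_const_mul (I u) J,
      integral_const_mul (J u) I, eI, eJ, eIJ]
    simp
  simp only [inner]
  rw [integral_add ((iIJ.sub' (iI.mul_const _)).sub' (iJ.mul_const _)) (integrable_const _),
    integral_sub (iIJ.sub' (iI.mul_const _)) (iJ.mul_const _),
    integral_sub iIJ (iI.mul_const _), integral_mul_const _ I, integral_mul_const _ J, eI, eJ, eIJ]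
  simp [jointDefect]
  ring

lemma measurable_jointDefect (ν : Measure (ℝ × ℝ)) [IsProbabilityMeasure ν] :
    Measurable fun q : ℝ × ℝ => jointDefect ν q.1 q.2 := by
  have h1 : Measurable fun q : ℝ × ℝ => ν {u | u.1 ≤ q.1 ∧ u.2 ≤ q.2} := by
    refine measurable_measure_prodMk_left (ν := ν)
      (s := {z : (ℝ × ℝ) × (ℝ × ℝ) | z.2.1 ≤ z.1.1 ∧ z.2.2 ≤ z.1.2}) ?_
    exact (measurableSet_le measurable_snd.fst measurable_fst.fst).inter
      (measurableSet_le measurable_snd.snd measurable_fst.snd)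
  have h2 : Measurable fun q : ℝ × ℝ => ν {u | u.1 ≤ q.1} := by
    refine measurable_measure_prodMk_left (ν := ν)
      (s := {z : (ℝ × ℝ) × (ℝ × ℝ) | z.2.1 ≤ z.1.1}) ?_
    exact (measurableSet_le (by fun_prop) (by fun_prop))
  have h3 : Measurable fun q : ℝ × ℝ => ν {u | u.2 ≤ q.2} := by
    refine measurable_measure_prodMk_left (ν := ν)
      (s := {z : (ℝ × ℝ) × (ℝ × ℝ) | z.2.2 ≤ z.1.2}) ?_
    exact (measurableSet_le (by fun_prop) (by fun_prop))
  exact h1.ennreal_toReal.sub (h2.ennreal_toReal.mul h3.ennreal_toReal)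

/-- Given the centre, the overlaps factor into the independent pairs of points `(0, 3)` and `(2, 1)`,
each contributing a factor `2 * jointDefect`. The function `ψ` selects the second coordinate of the
centre: that of point `4` or that of point `5`. -/
lemma integral_overlap_mul_overlap (ν : Measure (ℝ × ℝ)) [IsProbabilityMeasure ν]
    (ψ : ℝ × ℝ → ℝ × ℝ → ℝ) (hψ : Measurable fun z : (ℝ × ℝ) × (ℝ × ℝ) => ψ z.1 z.2) :
    ∫ p : Fin 6 → ℝ × ℝ, (overlap (p 0).1 (p 1).1 (p 2).1 (p 3).1 (p 4).1 : ℝ) *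
        overlap (p 0).2 (p 1).2 (p 2).2 (p 3).2 (ψ (p 4) (p 5)) ∂(Measure.pi fun _ => ν) =
      4 * ∫ m, ∫ n, jointDefect ν m.1 (ψ m n) ^ 2 ∂ν ∂ν := by
  -- relabel so that the points of the centre are integrated last and the pairs are adjacent
  let σ : Equiv.Perm (Fin 6) :=
    ⟨![2, 5, 4, 3, 0, 1], ![4, 5, 0, 3, 2, 1], by decide, by decide⟩
  have hσ : ∀ i, σ i = ![2, 5, 4, 3, 0, 1] i := fun i => rfl
  rw [← integral_pi_comp_perm ν _ σ]
  simp only [Function.comp_apply, hσ]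
  have hm (i : Fin 6) : Measurable fun p : Fin 6 → ℝ × ℝ => p i := measurable_pi_apply i
  have h4 : Measurable fun p : Fin 6 → ℝ × ℝ => ψ (p 0) (p 1) :=
    hψ.comp ((hm 0).prodMk (hm 1))
  refine (integral_pi_fin_six ν _ ((measurable_overlap (hm _).fst (hm _).fst (hm _).fst (hm _).fst
    (hm _).fst).fun_mul (measurable_overlap (hm _).snd (hm _).snd (hm _).snd (hm _).snd h4)) 1
    fun p => ?_).trans ?_
  · rw [abs_mul]
    exact mul_le_one₀ (abs_overlap_le_one _ _ _ _ _) (abs_nonneg _) (abs_overlap_le_one _ _ _ _ _)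
  · have key (m n : ℝ × ℝ) : ∫ a, ∫ b, ∫ c, ∫ d, (overlap a.1 d.1 c.1 b.1 m.1 : ℝ) *
        overlap a.2 d.2 c.2 b.2 (ψ m n) ∂ν ∂ν ∂ν ∂ν = 4 * jointDefect ν m.1 (ψ m n) ^ 2 := by
      have e (a b c d : ℝ × ℝ) : (overlap a.1 d.1 c.1 b.1 m.1 : ℝ) *
          overlap a.2 d.2 c.2 b.2 (ψ m n) = ((stepDiff a.1 b.1 m.1 : ℝ) * stepDiff a.2 b.2 (ψ m n)) *
            ((stepDiff c.1 d.1 m.1 : ℝ) * stepDiff c.2 d.2 (ψ m n)) := by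
        simp only [overlap]; push_cast; ring
      simp only [e, integral_const_mul, integral_mul_const, integral_stepDiff_mul_step]
      ring
    rw [← integral_const_mul]
    refine integral_congr_ae (.of_forall fun m => ?_)
    simp only
    rw [← integral_const_mul]
    refine integral_congr_ae (.of_forall fun n => ?_)
    exact key m n

/-- The mean of the product of crossing signs is `12 D + 24 R`. -/
theorem integral_crossing_mul_crossing (ν : Measure (ℝ × ℝ)) [IsProbabilityMeasure ν]
    (h1 : ∀ x, ν {q | q.1 = x} = 0) (h2 : ∀ y, ν {q | q.2 = y} = 0) :
    ∫ p : Fin 4 → ℝ × ℝ, (crossing (p 0).1 (p 1).1 (p 2).1 (p 3).1 : ℝ) *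
        crossing (p 0).2 (p 1).2 (p 2).2 (p 3).2 ∂(Measure.pi fun _ => ν) =
      12 * ∫ m, ∫ _n, jointDefect ν m.1 m.2 ^ 2 ∂ν ∂ν +
      24 * ∫ m, ∫ n, jointDefect ν m.1 n.2 ^ 2 ∂ν ∂ν := by
  have hm {k : ℕ} (i : Fin k) : Measurable fun p : Fin k → ℝ × ℝ => p i := measurable_pi_apply i
  have hA (k : ℕ) (i0 i1 i2 i3 : Fin k) : Measurable fun p : Fin k → ℝ × ℝ =>
      (crossing (p i0).1 (p i1).1 (p i2).1 (p i3).1 : ℝ) *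
        crossing (p i0).2 (p i1).2 (p i2).2 (p i3).2 :=
    (measurable_crossing (hm _).fst (hm _).fst (hm _).fst (hm _).fst).fun_mul
      (measurable_crossing (hm _).snd (hm _).snd (hm _).snd (hm _).snd)
  have bA {k : ℕ} (i0 i1 i2 i3 : Fin k) (p : Fin k → ℝ × ℝ) :
      |(crossing (p i0).1 (p i1).1 (p i2).1 (p i3).1 : ℝ) *
        crossing (p i0).2 (p i1).2 (p i2).2 (p i3).2| ≤ 1 := by
    rw [abs_mul]
    exact mul_le_one₀ (abs_crossing_le_one _ _ _ _) (abs_nonneg _) (abs_crossing_le_one _ _ _ _)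
  have iA : Integrable (fun p : Fin 6 → ℝ × ℝ =>
      (crossing (p 0).1 (p 1).1 (p 2).1 (p 3).1 : ℝ) *
        crossing (p 0).2 (p 1).2 (p 2).2 (p 3).2) (Measure.pi fun _ => ν) :=
    Integrable.of_bound (hA 6 0 1 2 3).aestronglyMeasurable 1 (.of_forall (bA 0 1 2 3))
  have iW (j : Fin 6) : Integrable (fun p : Fin 6 → ℝ × ℝ =>
      (overlap (p 0).1 (p 1).1 (p 2).1 (p 3).1 (p 4).1 : ℝ) *
        overlap (p 0).2 (p 1).2 (p 2).2 (p 3).2 (p j).2) (Measure.pi fun _ => ν) := by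
    refine Integrable.of_bound ((measurable_overlap (hm _).fst (hm _).fst (hm _).fst (hm _).fst
      (hm _).fst).fun_mul (measurable_overlap (hm _).snd (hm _).snd (hm _).snd (hm _).snd
      (hm _).snd)).aestronglyMeasurable 1 (.of_forall fun p => ?_)
    rw [Real.norm_eq_abs, abs_mul]
    exact mul_le_one₀ (abs_overlap_le_one _ _ _ _ _) (abs_nonneg _) (abs_overlap_le_one _ _ _ _ _)
  have hexp (p : Fin 6 → ℝ × ℝ) : (sixKernel (fun i => (p i).1) (fun i => (p i).2) : ℝ) =
      (crossing (p 0).1 (p 1).1 (p 2).1 (p 3).1 : ℝ) * crossing (p 0).2 (p 1).2 (p 2).2 (p 3).2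
      - 3 * ((overlap (p 0).1 (p 1).1 (p 2).1 (p 3).1 (p 4).1 : ℝ) *
        overlap (p 0).2 (p 1).2 (p 2).2 (p 3).2 (p 4).2)
      - 6 * ((overlap (p 0).1 (p 1).1 (p 2).1 (p 3).1 (p 4).1 : ℝ) *
        overlap (p 0).2 (p 1).2 (p 2).2 (p 3).2 (p 5).2) := by
    simp only [sixKernel]; push_cast; rfl
  have hint : Integrable (fun p : Fin 6 → ℝ × ℝ =>
      (sixKernel (fun i => (p i).1) (fun i => (p i).2) : ℝ)) (Measure.pi fun _ => ν) := by
    simp only [hexp]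
    exact (iA.sub' ((iW 4).const_mul 3)).sub ((iW 5).const_mul 6)
  have h0 := integral_sixKernel_eq_zero ν h1 h2 hint
  simp only [hexp] at h0
  rw [integral_sub (iA.sub' ((iW 4).const_mul 3)) ((iW 5).const_mul 6),
    integral_sub iA ((iW 4).const_mul 3), integral_const_mul, integral_const_mul,
    integral_overlap_mul_overlap ν (fun m _ => m.2) (by fun_prop),
    integral_overlap_mul_overlap ν (fun _ n => n.2) (by fun_prop)] at h0
  have h4 := integral_pi_fin_six_of_four ν _ (hA 4 0 1 2 3) 1 (bA 0 1 2 3)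
  rw [← h4]
  simp only [Matrix.cons_val]
  linarith

/-! ### Vanishing of the defect and independence -/

section
variable (ν : Measure (ℝ × ℝ)) [IsProbabilityMeasure ν]

lemma abs_jointDefect_le_one (s t : ℝ) : |jointDefect ν s t| ≤ 1 := by
  have h (A : Set (ℝ × ℝ)) : 0 ≤ ν.real A ∧ ν.real A ≤ 1 := ⟨measureReal_nonneg, measureReal_le_one⟩
  obtain ⟨a0, a1⟩ := h {q | q.1 ≤ s ∧ q.2 ≤ t}
  obtain ⟨b0, b1⟩ := h {q | q.1 ≤ s}
  obtain ⟨c0, c1⟩ := h {q | q.2 ≤ t}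
  have := mul_nonneg b0 c0
  have := mul_le_one₀ b1 c0 c1
  rw [jointDefect, abs_le]
  constructor <;> linarith

lemma cdf_map_fst (s : ℝ) : cdf (ν.map Prod.fst) s = ν.real {q | q.1 ≤ s} := by
  have := Measure.isProbabilityMeasure_map (μ := ν) (f := Prod.fst) (by fun_prop)
  rw [cdf_eq_real, map_measureReal_apply measurable_fst measurableSet_Iic]
  rfl

lemma cdf_map_snd (t : ℝ) : cdf (ν.map Prod.snd) t = ν.real {q | q.2 ≤ t} := by
  have := Measure.isProbabilityMeasure_map (μ := ν) (f := Prod.snd) (by fun_prop)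
  rw [cdf_eq_real, map_measureReal_apply measurable_snd measurableSet_Iic]
  rfl
end

lemma measure_singleton_eq_zero_of_continuous_cdf (m : Measure ℝ) [IsProbabilityMeasure m]
    (h : Continuous (cdf m)) (x : ℝ) : m {x} = 0 := by
  rw [← measure_cdf m, StieltjesFunction.measure_singleton,
    h.continuousAt.continuousWithinAt.leftLim_eq, sub_self, ENNReal.ofReal_zero]

/-- To the left of a point where a continuous distribution function is positive, there is an interval
of positive mass at most `ε`. -/
lemma exists_cdf_lt_near (m : Measure ℝ) (h : Continuous (cdf m)) {s ε : ℝ}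
    (hs : 0 < cdf m s) (hε : 0 < ε) : ∃ r, cdf m r < cdf m s ∧ cdf m s ≤ cdf m r + ε := by
  set y := cdf m s - min ε (cdf m s / 2) with hy
  have hmin : 0 < min ε (cdf m s / 2) := lt_min hε (by linarith)
  have hy0 : 0 < y := by
    have := min_le_right ε (cdf m s / 2)
    linarith
  obtain ⟨r', hr'⟩ := ((tendsto_cdf_atBot m).eventually_lt_const hy0).exists
  obtain ⟨r, hr⟩ := mem_range_of_exists_le_of_exists_ge h ⟨r', hr'.le⟩ ⟨s, by linarith⟩
  have := min_le_left ε (cdf m s / 2)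
  exact ⟨r, by linarith, by linarith⟩

/-- If `H = jointDefect ν` were nonzero at `(s, t)`, choose strips `A` and `B` ending at `s` and `t`
of positive mass at most `|H s t| / 4`: on `A × B`, `H` differs from `H s t` by at most
`|H s t| / 2`, so it does not vanish on a set of positive measure. -/
lemma jointDefect_eq_zero_of_integral_eq_zero (ν : Measure (ℝ × ℝ)) [IsProbabilityMeasure ν]
    (h1 : Continuous (cdf (ν.map Prod.fst))) (h2 : Continuous (cdf (ν.map Prod.snd)))
    (h0 : ∫ m, ∫ n, jointDefect ν m.1 n.2 ^ 2 ∂ν ∂ν = 0) (s t : ℝ) : jointDefect ν s t = 0 := by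
  set g : (ℝ × ℝ) × (ℝ × ℝ) → ℝ := fun z => jointDefect ν z.1.1 z.2.2 ^ 2 with hg
  have hgm : Measurable g :=
    ((measurable_jointDefect ν).comp (measurable_fst.fst.prodMk measurable_snd.snd)).pow_const 2
  have hgi : Integrable g (ν.prod ν) := by
    refine Integrable.of_bound hgm.aestronglyMeasurable 1 (.of_forall fun z => ?_)
    rw [Real.norm_eq_abs, hg, abs_pow]
    exact pow_le_one₀ (abs_nonneg _) (abs_jointDefect_le_one ν _ _)
  have hae : g =ᵐ[ν.prod ν] 0 := by
    rw [← integral_eq_zero_iff_of_nonneg (fun z => sq_nonneg _) hgi, integral_prod _ hgi]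
    exact h0
  by_contra hne
  have hδ : 0 < |jointDefect ν s t| := abs_pos.2 hne
  set F : ℝ → ℝ → ℝ := fun s t => ν.real {q | q.1 ≤ s ∧ q.2 ≤ t} with hF
  set G : ℝ → ℝ := fun s => ν.real {q | q.1 ≤ s} with hG
  set K : ℝ → ℝ := fun t => ν.real {q | q.2 ≤ t} with hK
  have hdef (s t) : jointDefect ν s t = F s t - G s * K t := rfl
  have G01 (s) : 0 ≤ G s ∧ G s ≤ 1 := ⟨measureReal_nonneg, measureReal_le_one⟩
  have K01 (s) : 0 ≤ K s ∧ K s ≤ 1 := ⟨measureReal_nonneg, measureReal_le_one⟩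
  have F0 : 0 ≤ F s t := measureReal_nonneg
  have FG : F s t ≤ G s := measureReal_mono fun q hq => hq.1
  have FK : F s t ≤ K t := measureReal_mono fun q hq => hq.2
  have Gpos : 0 < G s := by
    refine (G01 s).1.lt_of_ne fun h => hne ?_
    rw [hdef, ← h]; linarith
  have Kpos : 0 < K t := by
    refine (K01 t).1.lt_of_ne fun h => hne ?_
    rw [hdef, ← h]; linarith
  obtain ⟨a, ha1, ha2⟩ := exists_cdf_lt_near _ h1 (s := s)
    (by rw [cdf_map_fst]; exact Gpos) (ε := |jointDefect ν s t| / 4) (by linarith)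
  obtain ⟨b, hb1, hb2⟩ := exists_cdf_lt_near _ h2 (s := t)
    (by rw [cdf_map_snd]; exact Kpos) (ε := |jointDefect ν s t| / 4) (by linarith)
  have hGm : Monotone G := fun x y hxy => measureReal_mono fun q hq => le_trans hq hxy
  have hKm : Monotone K := fun x y hxy => measureReal_mono fun q hq => le_trans hq hxy
  simp only [cdf_map_fst] at ha1 ha2
  simp only [cdf_map_snd] at hb1 hb2
  change G a < G s at ha1
  change G s ≤ G a + _ at ha2
  change K b < K t at hb1
  change K t ≤ K b + _ at hb2
  set A : Set (ℝ × ℝ) := {q | a < q.1 ∧ q.1 ≤ s} with hA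
  set B : Set (ℝ × ℝ) := {q | b < q.2 ∧ q.2 ≤ t} with hB
  have hApos : ν A ≠ 0 := by
    intro h
    have : G s ≤ G a + ν.real A := by
      refine (measureReal_mono ?_).trans (measureReal_union_le _ _)
      intro q hq
      by_cases hqa : q.1 ≤ a
      · exact Or.inl hqa
      · exact Or.inr ⟨not_le.1 hqa, hq⟩
    rw [Measure.real, h, ENNReal.toReal_zero] at this
    linarith
  have hBpos : ν B ≠ 0 := by
    intro h
    have : K t ≤ K b + ν.real B := by
      refine (measureReal_mono ?_).trans (measureReal_union_le _ _)
      intro q hq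
      by_cases hqb : q.2 ≤ b
      · exact Or.inl hqb
      · exact Or.inr ⟨not_le.1 hqb, hq⟩
    rw [Measure.real, h, ENNReal.toReal_zero] at this
    linarith
  have hAB : A ×ˢ B ⊆ {z | g z ≠ 0} := by
    rintro ⟨u, v⟩ ⟨⟨hu1, hu2⟩, hv1, hv2⟩
    simp only at hu1 hu2 hv1 hv2
    have hGu1 := hGm hu1.le
    have hGu2 := hGm hu2
    have hKv1 := hKm hv1.le
    have hKv2 := hKm hv2
    have hF1 : F u.1 v.2 ≤ F s t := measureReal_mono fun q hq => ⟨hq.1.trans hu2, hq.2.trans hv2⟩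
    have hF2 : F s t + G u.1 + K v.2 ≤ F u.1 v.2 + G s + K t := by
      have hGd : ν.real ({q | q.1 ≤ s} \ {q | q.1 ≤ u.1}) = G s - G u.1 :=
        measureReal_sdiff (fun q hq => le_trans hq hu2)
          (measurableSet_le measurable_fst measurable_const)
      have hKd : ν.real ({q | q.2 ≤ t} \ {q | q.2 ≤ v.2}) = K t - K v.2 :=
        measureReal_sdiff (fun q hq => le_trans hq hv2)
          (measurableSet_le measurable_snd measurable_const)
      have hsub : {q : ℝ × ℝ | q.1 ≤ s ∧ q.2 ≤ t} ⊆ {q | q.1 ≤ u.1 ∧ q.2 ≤ v.2} ∪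
          (({q | q.1 ≤ s} \ {q | q.1 ≤ u.1}) ∪ ({q | q.2 ≤ t} \ {q | q.2 ≤ v.2})) := by
        rintro q ⟨hq1, hq2⟩
        by_cases k1 : q.1 ≤ u.1
        · by_cases k2 : q.2 ≤ v.2
          · exact Or.inl ⟨k1, k2⟩
          · exact Or.inr (Or.inr ⟨hq2, k2⟩)
        · exact Or.inr (Or.inl ⟨hq1, k1⟩)
      have := (measureReal_mono (μ := ν) hsub).trans (measureReal_union_le _ _)
      have := measureReal_union_le (μ := ν) ({q | q.1 ≤ s} \ {q | q.1 ≤ u.1})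
        ({q | q.2 ≤ t} \ {q | q.2 ≤ v.2})
      change F s t ≤ F u.1 v.2 + _ at *
      linarith
    have hprod : 0 ≤ G s * K t - G u.1 * K v.2 ∧
        G s * K t - G u.1 * K v.2 ≤ (G s - G u.1) + (K t - K v.2) := by
      constructor
      · have := mul_le_mul hGu2 hKv2 (K01 _).1 (G01 _).1
        linarith
      · nlinarith [G01 s, K01 t, G01 u.1, K01 v.2]
    intro hz
    have hz' : jointDefect ν u.1 v.2 = 0 := by simpa [hg] using hz
    rw [hdef] at hz'
    have : |jointDefect ν s t| ≤ |jointDefect ν s t| / 2 := by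
      refine abs_le'.2 ⟨?_, ?_⟩ <;> linarith [hdef s t]
    linarith
  have hnull : (ν.prod ν) (A ×ˢ B) = 0 := measure_mono_null hAB (ae_iff.1 hae)
  rw [Measure.prod_prod, mul_eq_zero] at hnull
  exact hnull.elim hApos hBpos

lemma indepFun_iff_jointDefect_eq_zero {Ω : Type*} [MeasurableSpace Ω] (μ : Measure Ω)
    [IsProbabilityMeasure μ] {X Y : Ω → ℝ} (hX : Measurable X) (hY : Measurable Y) :
    IndepFun X Y μ ↔ ∀ s t, jointDefect (μ.map fun ω => (X ω, Y ω)) s t = 0 := by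
  have hXY : Measurable fun ω => (X ω, Y ω) := hX.prodMk hY
  have key (s t : ℝ) : jointDefect (μ.map fun ω => (X ω, Y ω)) s t = 0 ↔
      μ (X ⁻¹' Set.Iic s ∩ Y ⁻¹' Set.Iic t) = μ (X ⁻¹' Set.Iic s) * μ (Y ⁻¹' Set.Iic t) := by
    have hm1 : MeasurableSet {q : ℝ × ℝ | q.1 ≤ s} :=
      measurableSet_le measurable_fst measurable_const
    have hm2 : MeasurableSet {q : ℝ × ℝ | q.2 ≤ t} :=
      measurableSet_le measurable_snd measurable_const
    have hm12 : MeasurableSet {q : ℝ × ℝ | q.1 ≤ s ∧ q.2 ≤ t} := hm1.inter hm2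
    rw [jointDefect, map_measureReal_apply hXY hm12, map_measureReal_apply hXY hm1,
      map_measureReal_apply hXY hm2, sub_eq_zero, Measure.real, Measure.real, Measure.real,
      ← ENNReal.toReal_mul, ENNReal.toReal_eq_toReal_iff' (measure_ne_top _ _)
      (ENNReal.mul_ne_top (measure_ne_top _ _) (measure_ne_top _ _))]
    rfl
  simp only [key]
  constructor
  · intro h s t
    exact h.measure_inter_preimage_eq_mul _ _ measurableSet_Iic measurableSet_Iic
  · intro h
    have hgen (Z : Ω → ℝ) : MeasurableSpace.comap Z inferInstance =
        MeasurableSpace.generateFrom (Set.preimage Z '' Set.range Set.Iic) := by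
      rw [← MeasurableSpace.comap_generateFrom, ← borel_eq_generateFrom_Iic]
      exact congrArg _ (BorelSpace.measurable_eq (α := ℝ))
    rw [IndepFun_iff_Indep, hgen X, hgen Y]
    have hpi (Z : Ω → ℝ) : IsPiSystem (Set.preimage Z '' Set.range Set.Iic) := by
      rintro _ ⟨_, ⟨a, rfl⟩, rfl⟩ _ ⟨_, ⟨b, rfl⟩, rfl⟩ -
      exact ⟨Set.Iic (a ⊓ b), ⟨_, rfl⟩, by rw [← Set.Iic_inter_Iic]; rfl⟩
    refine IndepSets.indep' ?_ ?_ (hpi X) (hpi Y) ?_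
    · rintro _ ⟨_, ⟨a, rfl⟩, rfl⟩
      exact hX measurableSet_Iic
    · rintro _ ⟨_, ⟨a, rfl⟩, rfl⟩
      exact hY measurableSet_Iic
    · rw [IndepSets_iff]
      rintro _ _ ⟨_, ⟨s, rfl⟩, rfl⟩ ⟨_, ⟨t, rfl⟩, rfl⟩
      exact h s t

theorem theorem1 {Ω : Type*} [MeasurableSpace Ω] (μ : Measure Ω) [IsProbabilityMeasure μ]
    (X Y : Ω → ℝ) (hX : Measurable X) (hY : Measurable Y)
    (hXc : Continuous (cdf (μ.map X))) (hYc : Continuous (cdf (μ.map Y))) :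
    0 ≤ tauStar μ X Y ∧ (tauStar μ X Y = 0 ↔ IndepFun X Y μ) := by
  have hXY : Measurable fun ω => (X ω, Y ω) := hX.prodMk hY
  rw [indepFun_iff_jointDefect_eq_zero μ hX hY]
  simp only [tauStar, signA_eq_crossing]
  set ν : Measure (ℝ × ℝ) := μ.map fun ω => (X ω, Y ω) with hν
  have hνp : IsProbabilityMeasure ν := Measure.isProbabilityMeasure_map hXY.aemeasurable
  have hXp : IsProbabilityMeasure (μ.map X) := Measure.isProbabilityMeasure_map hX.aemeasurable
  have hYp : IsProbabilityMeasure (μ.map Y) := Measure.isProbabilityMeasure_map hY.aemeasurable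
  have e1 : ν.map Prod.fst = μ.map X := by
    rw [hν, Measure.map_map measurable_fst hXY]; rfl
  have e2 : ν.map Prod.snd = μ.map Y := by
    rw [hν, Measure.map_map measurable_snd hXY]; rfl
  have h1 (x : ℝ) : ν {q | q.1 = x} = 0 := by
    have := measure_singleton_eq_zero_of_continuous_cdf _ hXc x
    rwa [← e1, Measure.map_apply measurable_fst (measurableSet_singleton x)] at this
  have h2 (y : ℝ) : ν {q | q.2 = y} = 0 := by
    have := measure_singleton_eq_zero_of_continuous_cdf _ hYc y
    rwa [← e2, Measure.map_apply measurable_snd (measurableSet_singleton y)] at this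
  rw [integral_crossing_mul_crossing ν h1 h2]
  have hD : 0 ≤ ∫ m, ∫ _n, jointDefect ν m.1 m.2 ^ 2 ∂ν ∂ν :=
    integral_nonneg fun _ => integral_nonneg fun _ => sq_nonneg _
  have hR : 0 ≤ ∫ m, ∫ n, jointDefect ν m.1 n.2 ^ 2 ∂ν ∂ν :=
    integral_nonneg fun _ => integral_nonneg fun _ => sq_nonneg _
  refine ⟨by linarith, fun h => ?_, fun h => by simp [h]⟩
  exact jointDefect_eq_zero_of_integral_eq_zero ν (e1 ▸ hXc) (e2 ▸ hYc) (by linarith)
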